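/- All graphs are finite and simple. A \emph{cover} of a graph $G$ is a pair $\mathcal{H}=(L,H)$ of a graph $H$ and a map $L\colon V(G)\to\mathcal{P}(V(H))$ such that the sets $L(u)$, $u\in V(G)$, partition $V(H)$; each $L(u)$ induces a complete subgraph of $H$; if $H$ has an edge between $L(u)$ and $L(v)$, then $u=v$ or $uv\in E(G)$; and for each $uv\in E(G)$ the edges of $H$ between $L(u)$ and $L(v)$ form a (possibly empty) matching. The cover is $k$-\emph{fold} if $|L(u)|=k$ for all $u\in V(G)$. For $\eta\in[0,1]$, an $(\eta,\mathcal{H})$-\emph{coloring} of $G$ is a set $S\subseteq V(H)$ that spans no edge of $H$ between distinct parts $L(u)$, $L(v)$ and satisfies $|S\cap L(u)|\ge\eta|L(u)|$ for all $u\in V(G)$. For $k\ge 1$ let $\theta_{DP}(G,k)$ be the largest $\eta\in[0,1]$ such that $G$ has an $(\eta,\mathcal{H})$-coloring for every $k$-fold cover $\mathcal{H}$ of $G$, and let the \emph{fractional DP-chromatic number} of $G$ be $$\chi^*_{DP}(G)=\inf\{\theta_{DP}(G,k)^{-1} : k\ge 1\}\qquad(\text{with } 0^{-1}=\infty).$$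 A graph is $d$-\emph{degenerate} if it has an orientation without directed cycles in which every out-degree is at most $d$. (i) There is a function $\delta\colon\mathbb{N}\to\mathbb{R}$ with $\delta(d)\to 0$ as $d\to\infty$ such that for every integer $d\ge 2$, every $d$-degenerate bipartite graph $G$ satisfies $$\chi^*_{DP}(G)\le(1+\delta(d))\,\frac{d}{\ln d}.$$ (ii) The constant factor $1$ in (i) is sharp, as witnessed by complete bipartite graphs: for every function $\omega\colon\mathbb{N}\to\mathbb{N}$ with $\omega(d)/d\to\infty$ as $d\to\infty$, there is a function $\delta\colon\mathbb{N}\to\mathbb{R}$ with $\delta(d)\to0$ as $d\to\infty$ such that for every integer $d\ge2$ $$\chi^*_{DP}(K_{d,\omega(d)})=(1+\delta(d))\,\frac{d}{\ln d}.$$ -/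

import Mathlib

open Filter Topology
open scoped ENNReal

universe u

namespace FracDP

/-- A cover `(L, H)` of a graph `G`, where `H` is a graph on the vertex set `W`. -/
structure Cover {V : Type u} (G : SimpleGraph V) (W : Type u) where
  /-- The graph `H`. -/
  H : SimpleGraph W
  /-- The lists `L(u) ⊆ V(H)`. -/
  L : V → Finset W
  /-- The lists partition the vertex set of `H`. -/
  partition : ∀ x : W, ∃! u : V, x ∈ L u
  /-- Every list induces a complete subgraph of `H`. -/
  complete : ∀ u : V, ∀ x ∈ L u, ∀ y ∈ L u, x ≠ y → H.Adj x y
  /-- Edges of `H` run within a list or between the lists of two adjacent vertices. -/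
  edge : ∀ u v : V, ∀ x ∈ L u, ∀ y ∈ L v, H.Adj x y → u = v ∨ G.Adj u v
  /-- The edges of `H` between the lists of two adjacent vertices form a (not necessarily perfect)
  matching. The condition is imposed for `(u, v)` and for `(v, u)`, hence on both sides. -/
  matching : ∀ u v : V, G.Adj u v → ∀ x ∈ L u, ∀ y ∈ L v, ∀ z ∈ L v,
    H.Adj x y → H.Adj x z → y = z

namespace Cover

variable {V W : Type u} {G : SimpleGraph V}

/-- The cover is `k`-fold if all lists have size `k`. -/
def IsFold (C : Cover G W) (k : ℕ) : Prop :=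
  ∀ u : V, (C.L u).card = k

/-- `S ⊆ V(H)` is quasi-independent if it spans no cross-edge, that is, no edge of `H` between the
lists of two distinct vertices. -/
def QuasiIndependent (C : Cover G W) (S : Set W) : Prop :=
  ∀ u v : V, u ≠ v → ∀ x ∈ S, ∀ y ∈ S, x ∈ C.L u → y ∈ C.L v → ¬ C.H.Adj x y

/-- `S` is an `(η, (L, H))`-coloring of `G`. -/
def IsFracColoring (C : Cover G W) (η : ℝ) (S : Set W) : Prop :=
  C.QuasiIndependent S ∧ ∀ u : V, η * ((C.L u).card : ℝ) ≤ ((S ∩ (C.L u : Set W)).ncard : ℝ)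

end Cover

/-- `θ_DP(G, k)`: the largest `η ∈ [0, 1]` such that `G` has an `(η, (L, H))`-coloring for every
`k`-fold cover `(L, H)` of `G`. For finite `G` every `k`-fold cover is finite, so that letting
`V(H)` range over the types in the universe of `V(G)` covers all of them up to isomorphism. -/
noncomputable def thetaDP {V : Type u} (G : SimpleGraph V) (k : ℕ) : ℝ :=
  sSup {η : ℝ | 0 ≤ η ∧ η ≤ 1 ∧
    ∀ (W : Type u) (C : Cover G W), C.IsFold k → ∃ S : Set W, C.IsFracColoring η S}

/-- The fractional DP-chromatic number `χ*_DP(G) = inf {θ_DP(G, k)⁻¹ : k ≥ 1}`. The infimum is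
taken in `[0, ∞]`, so that a value of `k` with `θ_DP(G, k) = 0` contributes `0⁻¹ = ∞`. -/
noncomputable def chiDP {V : Type u} (G : SimpleGraph V) : ℝ≥0∞ :=
  ⨅ (k : ℕ) (_ : 1 ≤ k), (ENNReal.ofReal (thetaDP G k))⁻¹

/-- The digraph `D` is an orientation of the graph `G`: every edge of `G` gets exactly one of its
two directions, and `D` has no other edges. -/
def IsOrientation {V : Type u} (G : SimpleGraph V) (D : Digraph V) : Prop :=
  (∀ u v : V, G.Adj u v ↔ D.Adj u v ∨ D.Adj v u) ∧ ∀ u v : V, D.Adj u v → ¬ D.Adj v u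

/-- `D` has no directed cycles: no vertex is reachable from itself by a directed walk of positive
length. -/
def IsAcyclicDigraph {V : Type u} (D : Digraph V) : Prop :=
  ∀ u : V, ¬ Relation.TransGen D.Adj u u

/-- `G` is `d`-degenerate: it has an acyclic orientation with all out-degrees at most `d`. -/
def IsDegenerate {V : Type u} (G : SimpleGraph V) (d : ℕ) : Prop :=
  ∃ D : Digraph V, IsOrientation G D ∧ IsAcyclicDigraph D ∧
    ∀ u : V, {v : V | D.Adj u v}.encard ≤ d

end FracDP

/-! Upper bound. Every η with 0 < η ≤ 1 and η ≤ (1 - η)^d gives χ*_DP(G) ≤ 1/η, and the root of η =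
(1 - η)^d is at least (1 - o(1)) ln d / d. Following an acyclic orientation of G with out-degrees at
most d, a random greedy procedure selects a vertex of H when its coin is active and no out-neighbor
was selected. The active sides are opposite on the two color classes, so selection is monotone in
the coins on one class and antitone on the other. The out-neighbors of x lie over one class, so by
the Harris inequality x is unblocked with probability at least (1 - η)^d ≥ η, and the bias of its
coin can be tuned to make its selection probability exactly η (`exists_coinExp_greedySel_eq`). Each
selection depends on a number of coins bounded independently of k, so for large k a second moment
argument gives nearly ηk selected vertices in all lists at once (`exists_isFracColoring`).

Lower bound. Let independent uniform permutations define the matchings over K_{a,b}. A fixed choice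
of s-sets in all lists is quasi-independent with probability at most exp(-ab s²/k), and there are (k
choose s)^(a+b) choices. The union bound (`mul_le_of_forall_isFracColoring`) restricts η by an
inequality free of k; for a = d and b = ω(d) it gives η ≤ (1 + o(1)) ln d / d. -/

namespace FracDP

/-! ### Independent biased coins and the Harris inequality -/

section Coins

variable {W : Type u} [Fintype W]

/-- The weight of the outcome `ζ` of independent coin flips, where the coin of `x` shows its active
side `c x` with probability `p x`. -/
noncomputable def coinWeight (c : W → Bool) (p : W → ℝ) (ζ : W → Bool) : ℝ :=
  ∏ x, if ζ x = c x then p x else 1 - p x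

theorem coinWeight_nonneg {c : W → Bool} {p : W → ℝ} (hp : ∀ x, 0 ≤ p x ∧ p x ≤ 1) (ζ : W → Bool) :
    0 ≤ coinWeight c p ζ := by
  refine Finset.prod_nonneg fun x _ => ?_
  split_ifs
  · exact (hp x).1
  · linarith [(hp x).2]

/-- The FKG lattice condition. For a product measure it is an equality, factor by factor, since at
each coordinate the meet and join merely permute the two values. -/
theorem coinWeight_mul_le {c : W → Bool} {p : W → ℝ} (a b : W → Bool) :
    coinWeight c p a * coinWeight c p b ≤ coinWeight c p (a ⊓ b) * coinWeight c p (a ⊔ b) := by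
  refine le_of_eq ?_
  simp only [coinWeight, ← Finset.prod_mul_distrib]
  refine Finset.prod_congr rfl fun x _ => ?_
  rcases le_total (a x) (b x) with h | h
  · simp only [show (a ⊓ b) x = a x from inf_eq_left.2 h,
      show (a ⊔ b) x = b x from sup_eq_right.2 h]
  · simp only [show (a ⊓ b) x = b x from inf_eq_right.2 h,
      show (a ⊔ b) x = a x from sup_eq_left.2 h, mul_comm]

variable [DecidableEq W]

/-- The expectation of `f` over independent coin flips. -/
noncomputable def coinExp (c : W → Bool) (p : W → ℝ) (f : (W → Bool) → ℝ) : ℝ :=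
  ∑ ζ, coinWeight c p ζ * f ζ

variable {c : W → Bool} {p q : W → ℝ} {f g : (W → Bool) → ℝ}

theorem coinExp_mono (hp : ∀ x, 0 ≤ p x ∧ p x ≤ 1) (h : ∀ ζ, f ζ ≤ g ζ) :
    coinExp c p f ≤ coinExp c p g :=
  Finset.sum_le_sum fun ζ _ => mul_le_mul_of_nonneg_left (h ζ) (coinWeight_nonneg hp ζ)

theorem coinExp_sub : coinExp c p (fun ζ => f ζ - g ζ) = coinExp c p f - coinExp c p g := by
  simp [coinExp, mul_sub, Finset.sum_sub_distrib]

theorem coinExp_sum {ι : Type*} (s : Finset ι) (F : ι → (W → Bool) → ℝ) :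
    coinExp c p (fun ζ => ∑ i ∈ s, F i ζ) = ∑ i ∈ s, coinExp c p (F i) := by
  simp only [coinExp, Finset.mul_sum]
  exact Finset.sum_comm

theorem sum_coinWeight_subtype (A : W → Prop) [DecidablePred A] :
    ∑ a : {x // A x} → Bool, ∏ x, (if a x = c x then p x else 1 - p x) = 1 := by
  have h := Finset.prod_univ_sum (fun _ : {x // A x} => (Finset.univ : Finset Bool))
    (fun x b => if b = c x then p x else 1 - p x)
  rw [Fintype.piFinset_univ] at h
  rw [← h]
  refine Finset.prod_eq_one fun x _ => ?_
  cases hx : c x <;> simp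

/-- Fubini for the coins inside and outside `A`. The outcome `z` is arbitrary padding at coordinates
that the functions ignore. -/
theorem coinExp_eq_sum_mul_sum (A : W → Prop) [DecidablePred A]
    (hf : DependsOn f {x | A x}) (hg : DependsOn g {x | ¬ A x}) (z : W → Bool) :
    coinExp c p (fun ζ => f ζ * g ζ) =
      (∑ a : {x // A x} → Bool, (∏ x, (if a x = c x then p x else 1 - p x)) *
          f (fun x => if h : A x then a ⟨x, h⟩ else z x)) *
        ∑ b : {x // ¬ A x} → Bool, (∏ x, (if b x = c x then p x else 1 - p x)) *
          g (fun x => if h : A x then z x else b ⟨x, h⟩) := by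
  rw [Finset.sum_mul_sum, ← Finset.sum_product', Finset.univ_product_univ, coinExp]
  refine Fintype.sum_equiv (Equiv.piEquivPiSubtypeProd A (fun _ => Bool)) _ _ fun ζ => ?_
  have h1 : coinWeight c p ζ = (∏ x : {x // A x}, (if ζ x = c x then p x else 1 - p x)) *
      ∏ x : {x // ¬ A x}, (if ζ x = c x then p x else 1 - p x) :=
    (Fintype.prod_subtype_mul_prod_subtype A
      (fun x => if ζ x = c x then p x else 1 - p x)).symm
  have h2 : f (fun x => if h : A x then ζ x else z x) = f ζ :=
    hf fun x hx => by simp only [Set.mem_ofPred_eq] at hx; simp [hx]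
  have h3 : g (fun x => if h : A x then z x else ζ x) = g ζ :=
    hg fun x hx => by simp only [Set.mem_ofPred_eq] at hx; simp [hx]
  simp only [Equiv.piEquivPiSubtypeProd_apply]
  rw [h1, h2, h3]
  ring

theorem coinExp_const (a : ℝ) : coinExp c p (fun _ => a) = a := by
  have h := coinExp_eq_sum_mul_sum (c := c) (p := p) (f := fun _ => a) (g := fun _ => 1)
    (fun _ => True) (fun _ _ _ => rfl) (fun _ _ _ => rfl) (fun _ => true)
  simp only [mul_one] at h
  rw [h, sum_coinWeight_subtype, ← Finset.sum_mul, sum_coinWeight_subtype]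
  ring

theorem coinExp_eq_sum (A : W → Prop) [DecidablePred A] (hf : DependsOn f {x | A x})
    (z : W → Bool) :
    coinExp c p f = ∑ a : {x // A x} → Bool, (∏ x, (if a x = c x then p x else 1 - p x)) *
          f (fun x => if h : A x then a ⟨x, h⟩ else z x) := by
  have h := coinExp_eq_sum_mul_sum (c := c) (p := p) (f := f) (g := fun _ => 1)
    A hf (fun _ _ _ => rfl) z
  simp only [mul_one] at h
  rw [sum_coinWeight_subtype] at h
  rw [h, mul_one]

/-- Functions of disjoint sets of coins are uncorrelated. -/
theorem coinExp_mul_of_disjoint {A B : Set W} (hf : DependsOn f A) (hg : DependsOn g B)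
    (hAB : Disjoint A B) :
    coinExp c p (fun ζ => f ζ * g ζ) = coinExp c p f * coinExp c p g := by
  classical
  have hg' : DependsOn g {x | ¬ x ∈ A} :=
    fun _ _ h => hg fun x hx => h x (Set.disjoint_right.1 hAB hx)
  have h1 := coinExp_eq_sum_mul_sum (c := c) (p := p) (f := f) (g := g)
    (· ∈ A) hf hg' (fun _ => true)
  have h2 := coinExp_eq_sum_mul_sum (c := c) (p := p) (f := fun _ => 1) (g := g)
    (· ∈ A) (fun _ _ _ => rfl) hg' (fun _ => true)
  have h3 := coinExp_eq_sum (c := c) (p := p) (f := f) (· ∈ A) hf (fun _ => true)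
  simp only [mul_one, one_mul] at h2
  rw [sum_coinWeight_subtype, one_mul] at h2
  rw [h1, h2, h3]

/-- The expectation of a function only depends on the biases of the coins it depends on. -/
theorem coinExp_congr {A : Set W} (hf : DependsOn f A) (hpq : ∀ x ∈ A, p x = q x) :
    coinExp c p f = coinExp c q f := by
  classical
  rw [coinExp_eq_sum (· ∈ A) hf (fun _ => true), coinExp_eq_sum (· ∈ A) hf (fun _ => true)]
  refine Finset.sum_congr rfl fun a _ => ?_
  congr 1
  exact Finset.prod_congr rfl fun x _ => by rw [hpq x x.2]

theorem coinExp_coin (x : W) : coinExp c p (fun ζ => if ζ x = c x then 1 else 0) = p x := by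
  -- The inactive side of `x` gets weight 0, so expanding the product keeps exactly the outcomes in
  -- which `x` is active.
  have h := Finset.prod_univ_sum (fun _ : W => (Finset.univ : Finset Bool))
    (fun y b => if b = c y then p y else if y = x then 0 else 1 - p y)
  have h1 : ∏ y, ∑ b, (if b = c y then p y else if y = x then 0 else 1 - p y) = p x := by
    rw [Finset.prod_eq_single x]
    · cases hx : c x <;> simp
    · intro y _ hy
      cases c y <;> simp [hy]
    · simp
  rw [Fintype.piFinset_univ, h1] at h
  rw [h, coinExp]
  refine Finset.sum_congr rfl fun ζ _ => ?_
  by_cases hx : ζ x = c x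
  · rw [if_pos hx, mul_one, coinWeight]
    refine Finset.prod_congr rfl fun y _ => ?_
    by_cases hy : y = x
    · subst hy; simp [hx]
    · simp [hy]
  · rw [if_neg hx, mul_zero, Finset.prod_eq_zero (Finset.mem_univ x) (by simp [hx])]

theorem coinExp_mul_le_of_monotone (hp : ∀ x, 0 ≤ p x ∧ p x ≤ 1) (hf₀ : 0 ≤ f) (hg₀ : 0 ≤ g)
    (hf : Monotone f) (hg : Monotone g) :
    coinExp c p f * coinExp c p g ≤ coinExp c p (fun ζ => f ζ * g ζ) := by
  have h := fkg f g (coinWeight c p) (fun ζ => coinWeight_nonneg hp ζ) hf₀ hg₀ hf hg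
    coinWeight_mul_le
  have h1 : ∑ ζ, coinWeight c p ζ = 1 := by
    have := coinExp_const (c := c) (p := p) 1
    simpa [coinExp] using this
  rw [h1, one_mul] at h
  exact h

theorem coinExp_mul_le_of_antitone (hp : ∀ x, 0 ≤ p x ∧ p x ≤ 1) (hf₀ : 0 ≤ f) (hg₀ : 0 ≤ g)
    (hf : Antitone f) (hg : Antitone g) :
    coinExp c p f * coinExp c p g ≤ coinExp c p (fun ζ => f ζ * g ζ) := by
  have h := fkg (α := (W → Bool)ᵒᵈ) (fun ζ => f (OrderDual.ofDual ζ))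
    (fun ζ => g (OrderDual.ofDual ζ)) (fun ζ => coinWeight c p (OrderDual.ofDual ζ))
    (fun ζ => coinWeight_nonneg hp _) (fun _ => hf₀ _) (fun _ => hg₀ _)
    (fun _ _ h => hf h) (fun _ _ h => hg h)
    (fun a b => (coinWeight_mul_le (OrderDual.ofDual a) (OrderDual.ofDual b)).trans_eq
      (mul_comm _ _))
  have h1 : ∑ ζ, coinWeight c p ζ = 1 := by
    have := coinExp_const (c := c) (p := p) 1
    simpa [coinExp] using this
  have h2 : ∀ F : (W → Bool) → ℝ, ∑ ζ : (W → Bool)ᵒᵈ, F (OrderDual.ofDual ζ) = ∑ ζ, F ζ :=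
    fun F => Fintype.sum_equiv OrderDual.ofDual _ _ fun _ => rfl
  rw [h2 (fun ζ => coinWeight c p ζ * f ζ), h2 (fun ζ => coinWeight c p ζ * g ζ), h2,
    h2 (fun ζ => coinWeight c p ζ * (f ζ * g ζ)), h1, one_mul] at h
  exact h

/-- The Harris inequality for several nonnegative functions that are all monotone or all antitone. -/
theorem prod_coinExp_le {ι : Type*} (hp : ∀ x, 0 ≤ p x ∧ p x ≤ 1) (s : Finset ι)
    (F : ι → (W → Bool) → ℝ) (hF₀ : ∀ i, 0 ≤ F i)
    (hF : (∀ i ∈ s, Monotone (F i)) ∨ ∀ i ∈ s, Antitone (F i)) :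
    ∏ i ∈ s, coinExp c p (F i) ≤ coinExp c p (fun ζ => ∏ i ∈ s, F i ζ) := by
  classical
  have hE₀ : ∀ f : (W → Bool) → ℝ, 0 ≤ f → 0 ≤ coinExp c p f := fun f hf =>
    Finset.sum_nonneg fun ζ _ => mul_nonneg (coinWeight_nonneg hp ζ) (hf ζ)
  induction s using Finset.induction_on with
  | empty => simp [coinExp_const]
  | insert i s hi ih =>
    have ih := ih (hF.imp (fun h j hj => h j (Finset.mem_insert_of_mem hj))
      (fun h j hj => h j (Finset.mem_insert_of_mem hj)))
    simp only [Finset.prod_insert hi]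
    have hP₀ : (0 : (W → Bool) → ℝ) ≤ fun ζ => ∏ i ∈ s, F i ζ :=
      fun ζ => Finset.prod_nonneg fun j _ => hF₀ j ζ
    refine (mul_le_mul_of_nonneg_left ih (hE₀ _ (hF₀ i))).trans ?_
    rcases hF with hF | hF
    · refine coinExp_mul_le_of_monotone hp (hF₀ i) hP₀ (hF i (Finset.mem_insert_self _ _)) ?_
      intro a b hab
      exact Finset.prod_le_prod (fun j _ => hF₀ j a)
        fun j hj => hF j (Finset.mem_insert_of_mem hj) hab
    · refine coinExp_mul_le_of_antitone hp (hF₀ i) hP₀ (hF i (Finset.mem_insert_self _ _)) ?_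
      intro a b hab
      exact Finset.prod_le_prod (fun j _ => hF₀ j b)
        fun j hj => hF j (Finset.mem_insert_of_mem hj) hab

theorem exists_le_of_coinExp_le (hp : ∀ x, 0 ≤ p x ∧ p x ≤ 1) {a : ℝ} (h : coinExp c p f ≤ a) :
    ∃ ζ, f ζ ≤ a := by
  by_contra! hcon
  have h1 : coinExp c p (fun ζ => f ζ - a) ≤ 0 := by
    rw [coinExp_sub, coinExp_const]; linarith
  have h2 : ∀ ζ, coinWeight c p ζ = 0 := by
    have h3 := (Finset.sum_eq_zero_iff_of_nonneg (s := Finset.univ)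
      (f := fun ζ => coinWeight c p ζ * (f ζ - a)) fun ζ _ =>
        mul_nonneg (coinWeight_nonneg hp ζ) (by linarith [hcon ζ])).1
      (le_antisymm h1 (Finset.sum_nonneg fun ζ _ =>
        mul_nonneg (coinWeight_nonneg hp ζ) (by linarith [hcon ζ])))
    intro ζ
    rcases mul_eq_zero.1 (h3 ζ (Finset.mem_univ _)) with h4 | h4
    · exact h4
    · linarith [hcon ζ]
  have h5 := coinExp_const (c := c) (p := p) 1
  simp [coinExp, h2] at h5

end Coins

/-! ### The greedy selection and its first two moments -/

section Greedy

variable {W : Type u}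

/-- The indicator of the event that the vertex `x` is selected by the greedy procedure that goes
through the vertices in the order of `r`, selecting those whose coin shows the active side and none
of whose out-neighbors has been selected. -/
noncomputable def greedySel (out : W → Finset W) (r : W → ℕ) (hr : ∀ x, ∀ y ∈ out x, r y < r x)
    (c ζ : W → Bool) (x : W) : ℝ :=
  (if ζ x = c x then 1 else 0) *
    ∏ y ∈ (out x).attach, (1 - greedySel out r hr c ζ y.1)
termination_by r x
decreasing_by exact hr x y.1 y.2

variable {out : W → Finset W} {r : W → ℕ} {hr : ∀ x, ∀ y ∈ out x, r y < r x} {c : W → Bool}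

theorem greedySel_eq (ζ : W → Bool) (x : W) :
    greedySel out r hr c ζ x =
      (if ζ x = c x then 1 else 0) * ∏ y ∈ out x, (1 - greedySel out r hr c ζ y) := by
  rw [greedySel, Finset.prod_attach (out x) (fun y => 1 - greedySel out r hr c ζ y)]

theorem greedySel_eq_zero_or_one (ζ : W → Bool) (x : W) :
    greedySel out r hr c ζ x = 0 ∨ greedySel out r hr c ζ x = 1 := by
  induction h : r x using Nat.strong_induction_on generalizing x with
  | _ n ih =>
    subst h
    rw [greedySel_eq]
    by_cases hx : ζ x = c x
    · rw [if_pos hx, one_mul]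
      by_cases hy : ∃ y ∈ out x, greedySel out r hr c ζ y = 1
      · obtain ⟨y, hy, h1⟩ := hy
        exact Or.inl (Finset.prod_eq_zero hy (by rw [h1, sub_self]))
      · push Not at hy
        refine Or.inr (Finset.prod_eq_one fun y hyx => ?_)
        rw [((ih (r y) (hr x y hyx) y rfl).resolve_right (hy y hyx)), sub_zero]
    · simp [hx]

theorem greedySel_nonneg (ζ : W → Bool) (x : W) : 0 ≤ greedySel out r hr c ζ x := by
  rcases greedySel_eq_zero_or_one (hr := hr) (c := c) ζ x with h | h <;> simp [h]

theorem greedySel_le_one (ζ : W → Bool) (x : W) : greedySel out r hr c ζ x ≤ 1 := by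
  rcases greedySel_eq_zero_or_one (hr := hr) (c := c) ζ x with h | h <;> simp [h]

theorem greedySel_eq_zero_of_mem_out {ζ : W → Bool} {x y : W} (hy : y ∈ out x)
    (h : greedySel out r hr c ζ y = 1) : greedySel out r hr c ζ x = 0 := by
  rw [greedySel_eq, Finset.prod_eq_zero hy (by rw [h, sub_self]), mul_zero]

/-- The vertices that can be reached from `x` along out-edges. -/
def reach (out : W → Finset W) (x : W) : Set W :=
  {z | Relation.ReflTransGen (fun a b => b ∈ out a) x z}

theorem mem_reach_self (x : W) : x ∈ reach out x := Relation.ReflTransGen.refl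

theorem reach_subset {x y : W} (hy : y ∈ out x) : reach out y ⊆ reach out x :=
  fun _ hz => Relation.ReflTransGen.head hy hz

theorem le_of_mem_reach (hr : ∀ x, ∀ y ∈ out x, r y < r x) {x z : W} (hz : z ∈ reach out x) :
    r z ≤ r x := by
  induction hz with
  | refl => exact le_rfl
  | tail _ h ih => exact (hr _ _ h).le.trans ih

theorem dependsOn_greedySel (x : W) :
    DependsOn (fun ζ => greedySel out r hr c ζ x) (reach out x) := by
  intro ζ ξ
  induction h : r x using Nat.strong_induction_on generalizing x with
  | _ n ih =>
    subst h
    intro hζ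
    simp only
    rw [greedySel_eq, greedySel_eq, hζ x (mem_reach_self x)]
    congr 1
    exact Finset.prod_congr rfl fun y hy => congrArg (1 - ·)
      (ih (r y) (hr x y hy) y rfl fun z hz => hζ z (reach_subset hy hz))

/-- Whether `x` is blocked is decided by coins of smaller rank, hence independently of the coin of
`x`. -/
theorem dependsOn_prod_greedySel (x : W) :
    DependsOn (fun ζ => ∏ y ∈ out x, (1 - greedySel out r hr c ζ y)) {z | r z < r x} :=
  fun _ _ h => Finset.prod_congr rfl fun y hy => congrArg (1 - ·)
    (dependsOn_greedySel y fun z hz => h z ((le_of_mem_reach hr hz).trans_lt (hr x y hy)))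

/-- Blocking reverses the direction of monotonicity, and so does passing to an out-neighbor, whose
active side is the other one; the two reversals cancel in the induction on rank. -/
theorem greedySel_monotone_antitone (hc : ∀ x, ∀ y ∈ out x, c y ≠ c x) (x : W) :
    (c x = true → Monotone fun ζ => greedySel out r hr c ζ x) ∧
      (c x = false → Antitone fun ζ => greedySel out r hr c ζ x) := by
  induction h : r x using Nat.strong_induction_on generalizing x with
  | _ n ih =>
    subst h
    constructor
    · intro hx a b hab
      simp only
      rw [greedySel_eq, greedySel_eq]
      refine mul_le_mul ?_ (Finset.prod_le_prod ?_ fun y hy => ?_)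
        (Finset.prod_nonneg ?_) (by split_ifs <;> norm_num)
      · have := Bool.le_iff_imp.1 (hab x)
        rw [hx]
        cases ha : a x <;> cases hb : b x <;> simp_all
      · exact fun y _ => sub_nonneg.2 (greedySel_le_one _ _)
      · have hy' : c y = false := by have := hc x y hy; rw [hx] at this; simpa using this
        exact sub_le_sub_left ((ih (r y) (hr x y hy) y rfl).2 hy' hab) 1
      · exact fun y _ => sub_nonneg.2 (greedySel_le_one _ _)
    · intro hx a b hab
      simp only
      rw [greedySel_eq, greedySel_eq]
      refine mul_le_mul ?_ (Finset.prod_le_prod ?_ fun y hy => ?_)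
        (Finset.prod_nonneg ?_) (by split_ifs <;> norm_num)
      · have := Bool.le_iff_imp.1 (hab x)
        rw [hx]
        cases ha : a x <;> cases hb : b x <;> simp_all
      · exact fun y _ => sub_nonneg.2 (greedySel_le_one _ _)
      · have hy' : c y = true := by have := hc x y hy; rw [hx] at this; simpa using this
        exact sub_le_sub_left ((ih (r y) (hr x y hy) y rfl).1 hy' hab) 1
      · exact fun y _ => sub_nonneg.2 (greedySel_le_one _ _)

variable [Fintype W] [DecidableEq W]

theorem prod_le_coinExp_prod_greedySel (hc : ∀ x, ∀ y ∈ out x, c y ≠ c x) {p : W → ℝ}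
    (hp : ∀ x, 0 ≤ p x ∧ p x ≤ 1) (x : W) :
    ∏ y ∈ out x, (1 - coinExp c p fun ζ => greedySel out r hr c ζ y) ≤
      coinExp c p fun ζ => ∏ y ∈ out x, (1 - greedySel out r hr c ζ y) := by
  have h := prod_coinExp_le (c := c) hp (out x) (fun y ζ => 1 - greedySel out r hr c ζ y)
    (fun y ζ => sub_nonneg.2 (greedySel_le_one _ _)) ?_
  · simpa only [coinExp_sub, coinExp_const] using h
  · cases hx : c x
    · refine Or.inr fun y hy a b hab => sub_le_sub_left
        ((greedySel_monotone_antitone hc y).1 ?_ hab) 1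
      have := hc x y hy
      rw [hx] at this
      simpa using this
    · refine Or.inl fun y hy a b hab => sub_le_sub_left
        ((greedySel_monotone_antitone hc y).2 ?_ hab) 1
      have := hc x y hy
      rw [hx] at this
      simpa using this

/-- The biases of the coins can be chosen such that every vertex is selected with the same
probability `η`. -/
theorem exists_coinExp_greedySel_eq (hc : ∀ x, ∀ y ∈ out x, c y ≠ c x) {d : ℕ}
    (hd : ∀ x, (out x).card ≤ d) {η : ℝ} (hη₀ : 0 < η) (hη₁ : η ≤ 1) (hη : η ≤ (1 - η) ^ d) :
    ∃ p : W → ℝ, (∀ x, 0 ≤ p x ∧ p x ≤ 1) ∧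
      ∀ x, (coinExp c p fun ζ => greedySel out r hr c ζ x) = η := by
  have key : ∀ n : ℕ, ∃ p : W → ℝ, (∀ x, 0 ≤ p x ∧ p x ≤ 1) ∧
      ∀ x, r x < n → (coinExp c p fun ζ => greedySel out r hr c ζ x) = η := by
    intro n
    induction n with
    | zero => exact ⟨fun _ => 0, fun _ => ⟨le_rfl, zero_le_one⟩, fun x hx => by omega⟩
    | succ n ih =>
      obtain ⟨p, hp, hpη⟩ := ih
      set A : W → ℝ := fun x => coinExp c p fun ζ => ∏ y ∈ out x, (1 - greedySel out r hr c ζ y)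
      -- Lower ranks are already tuned to η, so Harris bounds the probability `A x` of being
      -- unblocked below by a product of at most d factors 1 - η.
      have hA : ∀ x, r x = n → η ≤ A x := by
        intro x hx
        refine le_trans ?_ (prod_le_coinExp_prod_greedySel hc hp x)
        rw [Finset.prod_congr rfl fun y hy => by rw [hpη y (hx ▸ hr x y hy)], Finset.prod_const]
        exact hη.trans (pow_le_pow_of_le_one (by linarith) (by linarith) (hd x))
      -- The coin of `x` is independent of blocking, so bias η / `A x` yields selection probability
      -- η. Changing biases at rank `n` leaves lower ranks unaffected.
      refine ⟨fun x => if r x = n then η / A x else p x, fun x => ?_, fun x hx => ?_⟩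
      · simp only
        split_ifs with hx
        · have := hA x hx
          exact ⟨div_nonneg hη₀.le (hη₀.le.trans this), (div_le_one (by linarith)).2 this⟩
        · exact hp x
      · rcases (Nat.lt_succ_iff_lt_or_eq.1 hx) with hx | hx
        · rw [← hpη x hx]
          refine coinExp_congr (dependsOn_greedySel x) fun z hz => ?_
          have := le_of_mem_reach hr hz
          rw [if_neg (by omega)]
        · simp only [greedySel_eq _ x]
          rw [coinExp_mul_of_disjoint (A := {x}) (fun a b h => by simp [h x rfl])
            (dependsOn_prod_greedySel x) (by simp), coinExp_coin, if_pos hx,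
            coinExp_congr (q := p) (dependsOn_prod_greedySel x)]
          · have := hA x hx
            exact div_mul_cancel₀ η (by linarith)
          · intro z hz
            have hz : r z < r x := hz
            rw [if_neg (by omega)]
  obtain ⟨p, hp, h⟩ := key (Finset.univ.sup r + 1)
  exact ⟨p, hp, fun x => h x (Nat.lt_succ_of_le (Finset.le_sup (Finset.mem_univ x)))⟩

-- Expanding the square, pairs with disjoint reach are independent and contribute 0; any other pair
-- contributes at most 1, and each `x` is in at most `M` of those.
open Classical in
theorem coinExp_sum_greedySel_sub_sq_le {p : W → ℝ} (hp : ∀ x, 0 ≤ p x ∧ p x ≤ 1) {η : ℝ}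
    (hE : ∀ x, (coinExp c p fun ζ => greedySel out r hr c ζ x) = η) {M : ℕ} (L : Finset W)
    (hM : ∀ x ∈ L, (L.filter fun y => ¬ Disjoint (reach out x) (reach out y)).card ≤ M) :
    coinExp c p (fun ζ => (∑ x ∈ L, greedySel out r hr c ζ x - η * L.card) ^ 2) ≤
      L.card * M := by
  have h1 : ∀ ζ, (∑ x ∈ L, greedySel out r hr c ζ x - η * L.card) ^ 2 =
      ∑ x ∈ L, ∑ y ∈ L, (greedySel out r hr c ζ x - η) * (greedySel out r hr c ζ y - η) := by
    intro ζ
    rw [← Finset.sum_mul_sum, Finset.sum_sub_distrib, Finset.sum_const, nsmul_eq_mul]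
    ring
  simp only [h1, coinExp_sum]
  have hη : 0 ≤ η ∨ L = ∅ := by
    rcases L.eq_empty_or_nonempty with h | ⟨x, _⟩
    · exact Or.inr h
    · refine Or.inl ?_
      rw [← hE x, ← coinExp_const (c := c) (p := p) 0]
      exact coinExp_mono hp fun ζ => greedySel_nonneg _ _
  rcases hη with hη | rfl
  swap
  · simp
  have h2 : ∀ x y, coinExp c p (fun ζ => (greedySel out r hr c ζ x - η) *
      (greedySel out r hr c ζ y - η)) ≤
        if Disjoint (reach out x) (reach out y) then 0 else 1 := by
    intro x y
    split_ifs with h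
    · rw [coinExp_mul_of_disjoint
        (f := fun ζ => greedySel out r hr c ζ x - η) (g := fun ζ => greedySel out r hr c ζ y - η)
        (fun a b h => congrArg (· - η) (dependsOn_greedySel x h))
        (fun a b h => congrArg (· - η) (dependsOn_greedySel y h)) h, coinExp_sub, hE,
        coinExp_const, sub_self, zero_mul]
    · have hη1 : η ≤ 1 := by
        rw [← hE x, ← coinExp_const (c := c) (p := p) 1]
        exact coinExp_mono hp fun ζ => greedySel_le_one _ _
      rw [← coinExp_const (c := c) (p := p) 1]
      refine coinExp_mono hp fun ζ => ?_
      rcases greedySel_eq_zero_or_one (hr := hr) (c := c) ζ x with h | h <;>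
      rcases greedySel_eq_zero_or_one (hr := hr) (c := c) ζ y with h' | h' <;>
      rw [h, h'] <;> nlinarith
  calc _ ≤ ∑ x ∈ L, ∑ y ∈ L, (if Disjoint (reach out x) (reach out y) then (0 : ℝ) else 1) :=
        Finset.sum_le_sum fun x _ => Finset.sum_le_sum fun y _ => h2 x y
    _ ≤ ∑ x ∈ L, (M : ℝ) := by
        refine Finset.sum_le_sum fun x hx => ?_
        have := hM x hx
        rw [Finset.card_filter] at this
        refine le_trans (le_of_eq ?_) (Nat.cast_le.2 this)
        push_cast
        exact Finset.sum_congr rfl fun y _ => by split_ifs <;> simp_all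
    _ = _ := by rw [Finset.sum_const, nsmul_eq_mul]

end Greedy

/-! ### Counting dependent pairs -/

section Ball

variable {W : Type u} [DecidableEq W]

/-- The vertices within distance `l` of `x`, when `nbr y` is the closed neighborhood of `y`. -/
def nbrBall (nbr : W → Finset W) : ℕ → W → Finset W
  | 0, x => {x}
  | l + 1, x => (nbr x).biUnion (nbrBall nbr l)

variable {out nbr : W → Finset W} {r : W → ℕ}

theorem card_nbrBall_le {m : ℕ} (hm : ∀ x, (nbr x).card ≤ m) (l : ℕ) (x : W) :
    (nbrBall nbr l x).card ≤ m ^ l := by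
  induction l generalizing x with
  | zero => simp [nbrBall]
  | succ l ih =>
    rw [nbrBall, pow_succ']
    exact (Finset.card_biUnion_le_card_mul _ _ _ fun y _ => ih y).trans
      (Nat.mul_le_mul_right _ (hm x))

theorem nbrBall_trans {a b : ℕ} {x y z : W} (hxy : y ∈ nbrBall nbr a x)
    (hyz : z ∈ nbrBall nbr b y) : z ∈ nbrBall nbr (a + b) x := by
  induction a generalizing x with
  | zero =>
    rw [nbrBall, Finset.mem_singleton] at hxy
    rw [zero_add, ← hxy]
    exact hyz
  | succ a ih =>
    rw [nbrBall, Finset.mem_biUnion] at hxy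
    obtain ⟨w, hw, hwy⟩ := hxy
    rw [show a + 1 + b = a + b + 1 by ring, nbrBall, Finset.mem_biUnion]
    exact ⟨w, hw, ih hwy⟩

theorem nbrBall_symm (hsymm : ∀ x y, y ∈ nbr x → x ∈ nbr y) {l : ℕ} {x y : W}
    (h : y ∈ nbrBall nbr l x) : x ∈ nbrBall nbr l y := by
  induction l generalizing x with
  | zero => simpa [nbrBall, eq_comm] using h
  | succ l ih =>
    rw [nbrBall, Finset.mem_biUnion] at h
    obtain ⟨w, hw, hwy⟩ := h
    refine nbrBall_trans (ih hwy) ?_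
    simpa [nbrBall] using hsymm _ _ hw

theorem mem_nbrBall_self (hrefl : ∀ x, x ∈ nbr x) (l : ℕ) (x : W) : x ∈ nbrBall nbr l x := by
  induction l generalizing x with
  | zero => simp [nbrBall]
  | succ l ih => exact Finset.mem_biUnion.2 ⟨x, hrefl x, ih x⟩

/-- Rank drops along every out-edge, so a walk from `x` has at most `r x` steps. -/
theorem mem_nbrBall_of_mem_reach (hr : ∀ x, ∀ y ∈ out x, r y < r x) (hrefl : ∀ x, x ∈ nbr x)
    (hout : ∀ x, out x ⊆ nbr x) {x z : W} (hz : z ∈ reach out x) {l : ℕ} (hl : r x ≤ l) :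
    z ∈ nbrBall nbr l x := by
  induction hz using Relation.ReflTransGen.head_induction_on generalizing l with
  | refl => exact mem_nbrBall_self hrefl l z
  | head h _ ih =>
    have := hr _ _ h
    obtain ⟨l, rfl⟩ : ∃ k, l = k + 1 := ⟨l - 1, by omega⟩
    exact Finset.mem_biUnion.2 ⟨_, hout _ h, ih (by omega)⟩

end Ball

-- A vertex reached from both `x` and `y` is within distance `l` of each, so `y` lies in the ball of
-- radius 2`l` about `x`.
open Classical in
theorem card_filter_not_disjoint_reach_le {W : Type u} {out nbr : W → Finset W} {r : W → ℕ}
    (hr : ∀ x, ∀ y ∈ out x, r y < r x) (hrefl : ∀ x, x ∈ nbr x)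
    (hsymm : ∀ x y, y ∈ nbr x → x ∈ nbr y) (hout : ∀ x, out x ⊆ nbr x)
    {m l : ℕ} (hm : ∀ x, (nbr x).card ≤ m) (hl : ∀ x, r x ≤ l) (L : Finset W) (x : W) :
    (L.filter fun y => ¬ Disjoint (reach out x) (reach out y)).card ≤ m ^ (l + l) := by
  refine (Finset.card_le_card fun y hy => ?_).trans (card_nbrBall_le hm (l + l) x)
  obtain ⟨z, hzx, hzy⟩ := Set.not_disjoint_iff.1 (Finset.mem_filter.1 hy).2
  exact nbrBall_trans (mem_nbrBall_of_mem_reach hr hrefl hout hzx (hl x))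
    (nbrBall_symm hsymm (mem_nbrBall_of_mem_reach hr hrefl hout hzy (hl y)))

theorem exists_rank_of_acyclic {V : Type u} [Finite V] {D : Digraph V} (hD : IsAcyclicDigraph D) :
    ∃ r : V → ℕ, (∀ u v, D.Adj u v → r v < r u) ∧ ∀ u, r u ≤ Nat.card V := by
  -- The rank counts the vertices reachable by nonempty walks; acyclicity makes it drop strictly,
  -- since v does not reach itself.
  refine ⟨fun u => {v | Relation.TransGen D.Adj u v}.ncard, fun u v h => ?_, fun u => ?_⟩
  · refine Set.ncard_lt_ncard ⟨fun w hw => Relation.TransGen.head h hw, fun hsub => ?_⟩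
      (Set.toFinite _)
    exact hD v (hsub (Relation.TransGen.single h))
  · rw [← Set.ncard_univ]
    exact Set.ncard_le_ncard (Set.subset_univ _) Set.finite_univ

/-! ### Fractional colorings of covers of degenerate bipartite graphs -/

namespace Cover

variable {V W : Type u} {G : SimpleGraph V} (C : Cover G W)

/-- The vertex of `G` in whose list `x` lies. -/
noncomputable def proj (x : W) : V := (C.partition x).choose

theorem mem_L_proj (x : W) : x ∈ C.L (C.proj x) := (C.partition x).choose_spec.1

variable {C} in
theorem proj_eq_of_mem {x : W} {u : V} (h : x ∈ C.L u) : C.proj x = u :=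
  ((C.partition x).choose_spec.2 u h).symm

theorem finite_of_finite {V W : Type u} {G : SimpleGraph V} (C : Cover G W) [Finite V] : Finite W := by
  refine Set.finite_univ_iff.1 ((Set.finite_iUnion fun u => (C.L u).finite_toSet).subset ?_)
  exact fun x _ => Set.mem_iUnion.2 ⟨_, C.mem_L_proj x⟩

/-- A cross-edge joins lists of adjacent vertices. -/
theorem adj_proj {x y : W} (h : C.H.Adj x y) (hne : C.proj x ≠ C.proj y) :
    G.Adj (C.proj x) (C.proj y) :=
  (C.edge _ _ x (C.mem_L_proj x) y (C.mem_L_proj y) h).resolve_left hne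

theorem eq_of_adj_of_proj_eq {x y z : W} (hy : C.H.Adj x y) (hz : C.H.Adj x z)
    (hne : C.proj x ≠ C.proj y) (hyz : C.proj y = C.proj z) : y = z :=
  C.matching _ _ (C.adj_proj hy hne) x (C.mem_L_proj x) y (C.mem_L_proj y) z
    (hyz ▸ C.mem_L_proj z) hy hz

open Classical in
theorem exists_isFracColoring [Finite V] (hG : G.IsBipartite) {d : ℕ} (hd : IsDegenerate G d)
    {k : ℕ} (hk : C.IsFold k) {η η' : ℝ} (hη₀ : 0 < η) (hη₁ : η ≤ 1) (hη : η ≤ (1 - η) ^ d)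
    (hη' : η' ≤ η)
    (hk' : (Nat.card V : ℝ) * (Nat.card V ^ (Nat.card V + Nat.card V) : ℕ) ≤ (η - η') ^ 2 * k) :
    ∃ S : Set W, C.IsFracColoring η' S := by
  have := C.finite_of_finite
  have := Fintype.ofFinite W
  have := Fintype.ofFinite V
  obtain ⟨col⟩ := hG
  obtain ⟨D, ⟨hD, hD'⟩, hacyc, hdeg⟩ := hd
  obtain ⟨rk, hrk, hrkle⟩ := exists_rank_of_acyclic hacyc
  let out : W → Finset W := fun x =>
    Finset.univ.filter fun y => C.H.Adj x y ∧ D.Adj (C.proj x) (C.proj y)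
  -- The clique edges inside lists are left out: cross-edges form matchings, so `nbr x` has at most
  -- |V| elements, whatever k is.
  let nbr : W → Finset W := fun x =>
    Finset.univ.filter fun y => x = y ∨ C.H.Adj x y ∧ C.proj x ≠ C.proj y
  let r : W → ℕ := fun x => rk (C.proj x)
  -- The active side records the color class of the underlying vertex of G.
  let c : W → Bool := fun x => decide (col (C.proj x) = 0)
  have hDne : ∀ u v, D.Adj u v → u ≠ v := fun u v h => ((hD u v).2 (Or.inl h)).ne
  have mem_out : ∀ x y, y ∈ out x ↔ C.H.Adj x y ∧ D.Adj (C.proj x) (C.proj y) := by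
    simp [out]
  have mem_nbr : ∀ x y, y ∈ nbr x ↔ x = y ∨ C.H.Adj x y ∧ C.proj x ≠ C.proj y := by
    simp [nbr]
  have hr : ∀ x, ∀ y ∈ out x, r y < r x := fun x y hy => hrk _ _ ((mem_out x y).1 hy).2
  have hc : ∀ x, ∀ y ∈ out x, c y ≠ c x := by
    intro x y hy
    have h := col.valid ((hD _ _).2 (Or.inl ((mem_out x y).1 hy).2))
    simp only [c, ne_eq, decide_eq_decide]
    generalize col (C.proj x) = a at *
    generalize col (C.proj y) = b at *
    revert h
    fin_cases a <;> fin_cases b <;> simp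
  have hdout : ∀ x, (out x).card ≤ d := by
    intro x
    have h1 : (out x).card ≤ {v | D.Adj (C.proj x) v}.ncard := by
      rw [← Set.ncard_coe_finset]
      refine Set.ncard_le_ncard_of_injOn C.proj (fun y hy => ((mem_out x y).1 hy).2) ?_
        (Set.toFinite _)
      intro y hy z hz hyz
      have hy := (mem_out x y).1 hy
      have hz := (mem_out x z).1 hz
      exact C.eq_of_adj_of_proj_eq hy.1 hz.1 (hDne _ _ hy.2) hyz
    refine h1.trans ?_
    have h2 := hdeg (C.proj x)
    rw [← (Set.toFinite _).cast_ncard_eq] at h2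
    exact_mod_cast h2
  have hmnbr : ∀ x, (nbr x).card ≤ Nat.card V := by
    intro x
    rw [Nat.card_eq_fintype_card, ← Finset.card_univ]
    refine Finset.card_le_card_of_injOn C.proj (fun _ _ => Finset.mem_coe.2 (Finset.mem_univ _)) ?_
    intro y hy z hz hyz
    rcases (mem_nbr x y).1 hy with rfl | ⟨hy, hy'⟩ <;> rcases (mem_nbr _ z).1 hz with h | ⟨hz, hz'⟩
    · exact h
    · exact absurd hyz hz'
    · subst h; exact absurd hyz.symm hy'
    · exact C.eq_of_adj_of_proj_eq hy hz hy' hyz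
  obtain ⟨p, hp, hpη⟩ := exists_coinExp_greedySel_eq (hr := hr) hc hdout hη₀ hη₁ hη
  have hvar : ∀ u, coinExp c p
      (fun ζ => (∑ x ∈ C.L u, greedySel out r hr c ζ x - η * (C.L u).card) ^ 2) ≤
        (C.L u).card * (Nat.card V ^ (Nat.card V + Nat.card V) : ℕ) := fun u =>
    coinExp_sum_greedySel_sub_sq_le hp hpη (C.L u) fun x _ =>
      card_filter_not_disjoint_reach_le (nbr := nbr) hr (fun x => (mem_nbr x x).2 (Or.inl rfl))
        (fun x y h => (mem_nbr y x).2 (((mem_nbr x y).1 h).imp Eq.symm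
          fun h => ⟨h.1.symm, h.2.symm⟩))
        (fun x y h => (mem_nbr x y).2 (Or.inr ⟨((mem_out x y).1 h).1,
          hDne _ _ ((mem_out x y).1 h).2⟩)) hmnbr (fun x => hrkle _) _ x
  -- Summing the squared deviations over all lists lets a single outcome serve every list
  -- simultaneously.
  have hsum : coinExp c p (fun ζ => ∑ u,
      (∑ x ∈ C.L u, greedySel out r hr c ζ x - η * (C.L u).card) ^ 2) ≤
        ((η - η') * k) ^ 2 := by
    rw [coinExp_sum]
    calc _ ≤ ∑ u : V, ((C.L u).card * (Nat.card V ^ (Nat.card V + Nat.card V) : ℕ) : ℝ) :=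
          Finset.sum_le_sum fun u _ => hvar u
      _ = k * (Nat.card V * (Nat.card V ^ (Nat.card V + Nat.card V) : ℕ)) := by
          simp only [hk _, Finset.sum_const, nsmul_eq_mul, Finset.card_univ,
            Nat.card_eq_fintype_card]
          ring
      _ ≤ k * ((η - η') ^ 2 * k) := mul_le_mul_of_nonneg_left hk' (Nat.cast_nonneg _)
      _ = _ := by ring
  obtain ⟨ζ, hζ⟩ := exists_le_of_coinExp_le hp hsum
  refine ⟨{x | greedySel out r hr c ζ x = 1}, ?_, fun u => ?_⟩
  · intro u v huv x hx y hy hxu hyv hadj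
    have hx : greedySel out r hr c ζ x = 1 := hx
    have hy : greedySel out r hr c ζ y = 1 := hy
    obtain rfl := proj_eq_of_mem hxu
    obtain rfl := proj_eq_of_mem hyv
    rcases (hD _ _).1 (C.adj_proj hadj huv) with h | h
    · have := greedySel_eq_zero_of_mem_out ((mem_out x y).2 ⟨hadj, h⟩) hy
      linarith
    · have := greedySel_eq_zero_of_mem_out ((mem_out y x).2 ⟨hadj.symm, h⟩) hx
      linarith
  · have h1 : (({x | greedySel out r hr c ζ x = 1} ∩ (C.L u : Set W)).ncard : ℝ) =
        ∑ x ∈ C.L u, greedySel out r hr c ζ x := by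
      have : {x | greedySel out r hr c ζ x = 1} ∩ (C.L u : Set W) =
          ((C.L u).filter fun x => greedySel out r hr c ζ x = 1 : Finset W) := by
        ext x; simp [and_comm]
      rw [this, Set.ncard_coe_finset, Finset.card_filter]
      push_cast
      refine Finset.sum_congr rfl fun x _ => ?_
      rcases greedySel_eq_zero_or_one (hr := hr) (c := c) ζ x with h | h <;> simp [h]
    have h2 : (∑ x ∈ C.L u, greedySel out r hr c ζ x - η * (C.L u).card) ^ 2 ≤
        ((η - η') * k) ^ 2 :=
      (Finset.single_le_sum (f := fun u => (∑ x ∈ C.L u, greedySel out r hr c ζ x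
        - η * (C.L u).card) ^ 2) (fun _ _ => sq_nonneg _) (Finset.mem_univ u)).trans hζ
    have h3 := (abs_le_of_sq_le_sq' h2
      (mul_nonneg (sub_nonneg.2 hη') (Nat.cast_nonneg _))).1
    rw [h1]
    rw [hk u] at h3 ⊢
    linarith

end Cover

theorem le_thetaDP {V : Type u} {G : SimpleGraph V} {k : ℕ} {η : ℝ} (h₀ : 0 ≤ η) (h₁ : η ≤ 1)
    (h : ∀ (W : Type u) (C : Cover G W), C.IsFold k → ∃ S : Set W, C.IsFracColoring η S) :
    η ≤ thetaDP G k :=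
  le_csSup ⟨1, fun _ h => h.2.1⟩ ⟨h₀, h₁, h⟩

theorem chiDP_le_of_isDegenerate {V : Type u} [Finite V] {G : SimpleGraph V}
    (hG : G.IsBipartite) {d : ℕ} (hd : IsDegenerate G d) {η : ℝ} (hη₀ : 0 < η) (hη₁ : η ≤ 1)
    (hη : η ≤ (1 - η) ^ d) : chiDP G ≤ (ENNReal.ofReal η)⁻¹ := by
  rw [ENNReal.le_inv_iff_le_inv]
  -- Only values below η are attained, each for some large k; the infimum over k recovers η itself.
  refine le_of_forall_lt fun a ha => ?_
  have ha' : a ≠ ∞ := ha.ne_top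
  obtain ⟨η', hη'₀, rfl⟩ : ∃ η' : ℝ, 0 ≤ η' ∧ a = ENNReal.ofReal η' :=
    ⟨a.toReal, ENNReal.toReal_nonneg, (ENNReal.ofReal_toReal ha').symm⟩
  have hlt : η' < η := (ENNReal.ofReal_lt_ofReal_iff hη₀).1 ha
  obtain ⟨η'', h1, h2⟩ := exists_between hlt
  refine lt_of_lt_of_le ((ENNReal.ofReal_lt_ofReal_iff (by linarith)).2 h1) ?_
  rw [← ENNReal.le_inv_iff_le_inv]
  have hpos : 0 < (η - η'') ^ 2 := by have := sub_pos.2 h2; positivity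
  obtain ⟨k, hk⟩ := exists_nat_ge
    ((Nat.card V : ℝ) * (Nat.card V ^ (Nat.card V + Nat.card V) : ℕ) / (η - η'') ^ 2)
  have hk' : (Nat.card V : ℝ) * (Nat.card V ^ (Nat.card V + Nat.card V) : ℕ) ≤
      (η - η'') ^ 2 * (k + 1 : ℕ) := by
    rw [div_le_iff₀ hpos] at hk
    push_cast at hk ⊢
    nlinarith
  refine (iInf₂_le (k + 1) (by omega)).trans (ENNReal.inv_le_inv.2 (ENNReal.ofReal_le_ofReal ?_))
  exact le_thetaDP (by linarith) (by linarith) fun W C hC =>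
    C.exists_isFracColoring hG hd hC hη₀ hη₁ hη h2.le hk'

/-! ### Asymptotics of the root of x = (1 - x)^d -/

theorem exists_eq_one_sub_pow (d : ℕ) (hd : d ≠ 0) :
    ∃ η : ℝ, 0 < η ∧ η < 1 ∧ η = (1 - η) ^ d := by
  have hcont : ContinuousOn (fun x : ℝ => x - (1 - x) ^ d) (Set.Icc 0 1) := by fun_prop
  obtain ⟨η, ⟨h0, h1⟩, h⟩ := intermediate_value_Icc zero_le_one hcont
    (show (0 : ℝ) ∈ Set.Icc _ _ by simp [hd])
  have h : η - (1 - η) ^ d = 0 := h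
  refine ⟨η, h0.lt_of_ne ?_, h1.lt_of_ne ?_, by linarith⟩
  · rintro rfl; norm_num at h
  · rintro rfl; simp [hd] at h

/-- The number `(1 - ε) ln d / d` is eventually a lower bound for the root of `x = (1 - x) ^ d`. -/
theorem eventually_le_one_sub_pow {ε : ℝ} (hε₀ : 0 < ε) (hε₁ : ε < 1) :
    ∀ᶠ d : ℕ in atTop, (1 - ε) * (Real.log d / d) ≤ (1 - (1 - ε) * (Real.log d / d)) ^ d := by
  have hx : Tendsto (fun d : ℕ => (1 - ε) * (Real.log d / d)) atTop (𝓝 0) := by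
    have h := (Real.isLittleO_log_id_atTop.tendsto_div_nhds_zero).comp
      (tendsto_natCast_atTop_atTop (R := ℝ))
    simpa using h.const_mul (1 - ε)
  have h1 := hx.eventually (gt_mem_nhds (show (0 : ℝ) < ε / (1 + ε) by positivity))
  have h2 := ((isLittleO_log_rpow_atTop (show (0 : ℝ) < ε ^ 2 by positivity)).comp_tendsto
    (tendsto_natCast_atTop_atTop (R := ℝ))).bound one_pos
  filter_upwards [h1, h2, eventually_ge_atTop 2] with d h1 h2 hd
  have hd' : (2 : ℝ) ≤ d := by exact_mod_cast hd
  have hd0 : (0 : ℝ) < d := by linarith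
  have hlog : 0 < Real.log d := Real.log_pos (by linarith)
  set x := (1 - ε) * (Real.log d / d) with hxdef
  have hx0 : 0 < x := mul_pos (by linarith) (by positivity)
  have hx1 : x < 1 := h1.trans ((div_lt_one (by positivity)).2 (by linarith))
  rw [lt_div_iff₀ (by positivity)] at h1
  -- From -ln(1 - x) ≤ x/(1 - x) and x < ε/(1 + ε). Since (1 - ε)(1 + ε) = 1 - ε², this leaves (1 -
  -- x)^d ≥ d^(ε²)/d, which beats ln d / d.
  have hlow : -(x * (1 + ε)) ≤ Real.log (1 - x) := by
    refine le_trans ?_ (Real.one_sub_inv_le_log_of_pos (by linarith))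
    have : (1 - x)⁻¹ ≤ 1 + x * (1 + ε) := by
      rw [inv_le_iff_one_le_mul₀ (by linarith)]
      nlinarith
    linarith
  simp only [Function.comp, Real.norm_eq_abs, one_mul, abs_of_pos hlog] at h2
  rw [abs_of_pos (Real.rpow_pos_of_pos hd0 _)] at h2
  calc x ≤ Real.log d / d := by
        rw [hxdef]
        have : 0 < Real.log d / d := by positivity
        nlinarith
    _ ≤ (d : ℝ) ^ (ε ^ 2) / d := by gcongr
    _ = Real.exp (d * (-(x * (1 + ε)))) := by
        rw [Real.rpow_def_of_pos hd0, show (d : ℝ) * (-(x * (1 + ε))) =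
          Real.log d * ε ^ 2 - Real.log d by rw [hxdef]; field_simp; ring, Real.exp_sub,
          Real.exp_log hd0]
    _ ≤ Real.exp (d * Real.log (1 - x)) := by gcongr
    _ = (1 - x) ^ d := by rw [Real.exp_nat_mul, Real.exp_log (by linarith)]

theorem exists_chiDP_le_of_isDegenerate :
    ∃ δ : ℕ → ℝ, Tendsto δ atTop (𝓝 0) ∧
      ∀ d : ℕ, 2 ≤ d → ∀ (V : Type u) [Finite V] (G : SimpleGraph V),
        G.IsBipartite → IsDegenerate G d →
          chiDP G ≤ ENNReal.ofReal ((1 + δ d) * ((d : ℝ) / Real.log (d : ℝ))) := by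
  have hroot : ∀ d : ℕ, ∃ η : ℝ, d ≠ 0 → 0 < η ∧ η < 1 ∧ η = (1 - η) ^ d := fun d => by
    by_cases hd : d = 0
    · exact ⟨0, fun h => absurd hd h⟩
    · exact (exists_eq_one_sub_pow d hd).imp fun _ h _ => h
  choose η hη using hroot
  -- This makes 1 + δ(d) at least the ratio of 1/η to d / ln d for every d ≥ 2. Truncating at 0
  -- means that only an upper estimate is needed for convergence.
  refine ⟨fun d => max 0 (Real.log d / (d * η d) - 1), ?_, ?_⟩
  · rw [Metric.tendsto_nhds]
    intro ε hε
    have hε' : 0 < ε / (1 + ε) / 2 := by positivity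
    have hε'1 : ε / (1 + ε) / 2 < 1 := by
      have : ε / (1 + ε) < 1 := (div_lt_one (by positivity)).2 (by linarith)
      linarith
    filter_upwards [eventually_le_one_sub_pow hε' hε'1, eventually_ge_atTop 2] with d h hd
    have hd' : (2 : ℝ) ≤ d := by exact_mod_cast hd
    have hlog : 0 < Real.log d := Real.log_pos (by linarith)
    obtain ⟨h0, h1, h2⟩ := hη d (by omega)
    -- If the root were below x = (1 - ε') ln d / d, then x ≤ (1 - x)^d ≤ (1 - η)^d = η, a
    -- contradiction.
    have hle : (1 - ε / (1 + ε) / 2) * (Real.log d / d) ≤ η d := by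
      by_contra! hlt
      have : (1 - (1 - ε / (1 + ε) / 2) * (Real.log d / d)) ^ d ≤ (1 - η d) ^ d := by
        by_cases hneg : 0 ≤ 1 - (1 - ε / (1 + ε) / 2) * (Real.log d / d)
        · exact pow_le_pow_left₀ hneg (by linarith) d
        · exfalso
          have h3 : Real.log d / d ≤ 1 :=
            (div_le_one (by linarith)).2 ((Real.log_le_sub_one_of_pos (by linarith)).trans
              (by linarith))
          have h4 : 0 < Real.log d / d := div_pos hlog (by linarith)
          nlinarith
      linarith
    rw [Real.dist_eq, sub_zero, abs_of_nonneg (le_max_left _ _), max_lt_iff]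
    refine ⟨hε, ?_⟩
    rw [sub_lt_iff_lt_add, div_lt_iff₀ (by positivity)]
    have h5 : (1 - ε / (1 + ε) / 2) * Real.log d ≤ η d * d := by
      rw [mul_div_assoc', div_le_iff₀ (by linarith)] at hle
      exact hle
    have h6 : (ε + 1) * (1 - ε / (1 + ε) / 2) = 1 + ε / 2 := by field_simp; ring
    nlinarith
  · intro d hd V _ G hG hdeg
    have hd' : (2 : ℝ) ≤ d := by exact_mod_cast hd
    have hlog : 0 < Real.log d := Real.log_pos (by linarith)
    obtain ⟨h0, h1, h2⟩ := hη d (by omega)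
    refine (chiDP_le_of_isDegenerate hG hdeg h0 h1.le h2.le).trans ?_
    rw [← ENNReal.ofReal_inv_of_pos h0]
    refine ENNReal.ofReal_le_ofReal ?_
    calc (η d)⁻¹ = (1 + (Real.log d / (d * η d) - 1)) * (d / Real.log d) := by field_simp; ring
      _ ≤ _ := by gcongr; exact le_max_right _ _

/-! ### Random permutations moving one set off another -/

section Permutations

variable {α : Type*} [Fintype α] [DecidableEq α]

/-- Left multiplication by a permutation carrying one target set to the other is a bijection between
the two families. -/
theorem card_filter_map_eq {S A B : Finset α} (hAB : A.card = B.card) :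
    (Finset.univ.filter fun π : Equiv.Perm α => S.map π.toEmbedding = A).card =
      (Finset.univ.filter fun π : Equiv.Perm α => S.map π.toEmbedding = B).card := by
  obtain ⟨τ, hτ⟩ := Equiv.Perm.exists_map_finset_eq A B hAB
  refine Finset.card_equiv (Equiv.mulLeft τ) fun π => ?_
  simp only [Finset.mem_filter, Finset.mem_univ, true_and, Equiv.coe_mulLeft]
  have h : S.map (τ * π).toEmbedding = (S.map π.toEmbedding).map τ.toEmbedding := by
    rw [Finset.map_map]; rfl
  rw [h, ← hτ, Finset.map_inj]

/-- The number of permutations that move `S` off `T`. -/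
theorem card_filter_disjoint_map_mul_choose {s : ℕ} {S T : Finset α} (hS : S.card = s)
    (hT : T.card = s) :
    (Finset.univ.filter fun π : Equiv.Perm α => Disjoint (S.map π.toEmbedding) T).card *
        (Fintype.card α).choose s =
      (Fintype.card α).factorial * (Fintype.card α - s).choose s := by
  set N := (Finset.univ.filter fun π : Equiv.Perm α => S.map π.toEmbedding = S).card with hN
  have hNA : ∀ A : Finset α, A.card = s →
      (Finset.univ.filter fun π : Equiv.Perm α => S.map π.toEmbedding = A).card = N :=
    fun A hA => card_filter_map_eq (hA.trans hS.symm)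
  have h1 : (Fintype.card α).factorial = (Fintype.card α).choose s * N := by
    rw [← Fintype.card_perm, ← Finset.card_univ, Finset.card_eq_sum_card_fiberwise
      (f := fun π : Equiv.Perm α => S.map π.toEmbedding)
      (t := Finset.powersetCard s Finset.univ) fun π _ => by simp [hS],
      Finset.sum_congr rfl fun A hA => hNA A (Finset.mem_powersetCard.1 hA).2, Finset.sum_const,
      Finset.card_powersetCard, smul_eq_mul, Finset.card_univ]
  have h2 : (Finset.univ.filter fun π : Equiv.Perm α => Disjoint (S.map π.toEmbedding) T).card =
      (Fintype.card α - s).choose s * N := by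
    rw [Finset.card_eq_sum_card_fiberwise
      (f := fun π : Equiv.Perm α => S.map π.toEmbedding) (t := Finset.powersetCard s Tᶜ)]
    · rw [← hT, ← Finset.card_compl T, hT, ← Finset.card_powersetCard, ← smul_eq_mul,
        ← Finset.sum_const]
      refine Finset.sum_congr rfl fun A hA => ?_
      rw [Finset.mem_powersetCard] at hA
      rw [← hNA A hA.2, Finset.filter_filter]
      congr 1
      refine Finset.filter_congr fun π _ => ⟨fun h => h.2, fun h => ⟨?_, h⟩⟩
      rw [h]
      exact Finset.subset_compl_iff_disjoint_right.1 hA.1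
    · intro π hπ
      simp only [Finset.coe_filter, Finset.mem_univ, true_and] at hπ
      simp only [Finset.mem_coe, Finset.mem_powersetCard, Finset.card_map, hS, and_true]
      exact Finset.subset_compl_iff_disjoint_right.2 hπ
  rw [h1, h2]
  ring

/-- In terms of falling factorials this holds factor by factor: (k - s - i) k ≤ (k - i)(k - s). -/
theorem choose_sub_mul_pow_le (k s : ℕ) :
    (k - s).choose s * k ^ s ≤ k.choose s * (k - s) ^ s := by
  have h : (k - s).descFactorial s * k ^ s ≤ k.descFactorial s * (k - s) ^ s := by
    rw [Nat.descFactorial_eq_prod_range, Nat.descFactorial_eq_prod_range]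
    conv_lhs => rw [← Finset.card_range s, ← Finset.prod_const, Finset.card_range,
      ← Finset.prod_mul_distrib]
    conv_rhs => rw [← Finset.card_range s, ← Finset.prod_const, Finset.card_range,
      ← Finset.prod_mul_distrib]
    refine Finset.prod_le_prod' fun i _ => ?_
    rcases le_total (s + i) k with h | h
    · obtain ⟨l, rfl⟩ := Nat.exists_eq_add_of_le h
      rw [show s + i + l - s - i = l by omega, show s + i + l - i = s + l by omega,
        show s + i + l - s = i + l by omega]
      nlinarith
    · rw [show k - s - i = 0 by omega, zero_mul]
      exact Nat.zero_le _
  rw [Nat.descFactorial_eq_factorial_mul_choose, Nat.descFactorial_eq_factorial_mul_choose,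
    mul_assoc, mul_assoc] at h
  exact Nat.le_of_mul_le_mul_left h (Nat.factorial_pos s)

/-- The proportion of such permutations is at most (1 - s/k)^s ≤ exp(-s²/k). -/
theorem card_filter_disjoint_map_le {s : ℕ} {S T : Finset α} (hS : S.card = s)
    (hT : T.card = s) (hα : 0 < Fintype.card α) :
    ((Finset.univ.filter fun π : Equiv.Perm α => Disjoint (S.map π.toEmbedding) T).card : ℝ) ≤
      (Fintype.card α).factorial * Real.exp (-((s : ℝ) ^ 2 / Fintype.card α)) := by
  have hs : s ≤ Fintype.card α := hS ▸ Finset.card_le_univ S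
  have h1 := card_filter_disjoint_map_mul_choose hS hT
  have h2 := choose_sub_mul_pow_le (Fintype.card α) s
  set k := Fintype.card α
  set c := (Finset.univ.filter fun π : Equiv.Perm α => Disjoint (S.map π.toEmbedding) T).card
  have hk : (0 : ℝ) < k := by exact_mod_cast hα
  have hC : (0 : ℝ) < k.choose s := by exact_mod_cast Nat.choose_pos hs
  have h1' : (c : ℝ) * k.choose s = k.factorial * (k - s).choose s := by exact_mod_cast h1
  have h2' : ((k - s).choose s : ℝ) * k ^ s ≤ k.choose s * ((k : ℝ) - s) ^ s := by
    rw [← Nat.cast_sub hs]; exact_mod_cast h2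
  have h3 : ((k - s).choose s : ℝ) ≤ k.choose s * Real.exp (-((s : ℝ) ^ 2 / k)) := by
    have h4 : ((k : ℝ) - s) ^ s ≤ k ^ s * Real.exp (-((s : ℝ) ^ 2 / k)) := by
      have h5 : ((k : ℝ) - s) ≤ k * Real.exp (-(s / k)) := by
        have := Real.add_one_le_exp (-((s : ℝ) / k))
        calc ((k : ℝ) - s) = k * (-((s : ℝ) / k) + 1) := by field_simp; ring
          _ ≤ _ := by gcongr
      have h6 : (0 : ℝ) ≤ (k : ℝ) - s := sub_nonneg.2 (by exact_mod_cast hs)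
      calc ((k : ℝ) - s) ^ s ≤ (k * Real.exp (-(s / k))) ^ s := by gcongr
        _ = _ := by
          rw [mul_pow, ← Real.exp_nat_mul]
          congr 2
          ring
    have h7 : ((k - s).choose s : ℝ) * k ^ s ≤
        (k.choose s * Real.exp (-((s : ℝ) ^ 2 / k))) * k ^ s := by
      refine h2'.trans ((mul_le_mul_of_nonneg_left h4 hC.le).trans_eq (by ring))
    exact le_of_mul_le_mul_right h7 (by positivity)
  refine le_of_mul_le_mul_right ?_ hC
  rw [h1']
  calc _ ≤ (k.factorial : ℝ) * (k.choose s * Real.exp (-((s : ℝ) ^ 2 / k))) := by gcongr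
    _ = _ := by ring

end Permutations

/-! ### The first moment lower bound for complete bipartite graphs -/

/-- The cover of a complete bipartite graph with lists of size `k` in which the edges between the
lists of adjacent vertices are given by permutations. -/
def permCover {a b k : ℕ} (σ : Fin a × Fin b → Equiv.Perm (Fin k)) :
    Cover (completeBipartiteGraph (Fin a) (Fin b)) ((Fin a ⊕ Fin b) × Fin k) where
  H :=
    { Adj := fun p q => (p.1 = q.1 ∧ p.2 ≠ q.2) ∨
        (∃ i j, p.1 = Sum.inl i ∧ q.1 = Sum.inr j ∧ σ (i, j) p.2 = q.2) ∨
        (∃ i j, q.1 = Sum.inl i ∧ p.1 = Sum.inr j ∧ σ (i, j) q.2 = p.2)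
      symm := ⟨fun p q h => by
        rcases h with h | h | h
        · exact Or.inl ⟨h.1.symm, h.2.symm⟩
        · exact Or.inr (Or.inr h)
        · exact Or.inr (Or.inl h)⟩
      loopless := ⟨fun p h => by
        rcases h with h | ⟨i, j, h1, h2, _⟩ | ⟨i, j, h1, h2, _⟩
        · exact h.2 rfl
        · rw [h1] at h2; cases h2
        · rw [h1] at h2; cases h2⟩ }
  L := fun u => {u} ×ˢ Finset.univ
  partition := fun x => ⟨x.1, by simp, fun u hu =>
    (Finset.mem_singleton.1 (Finset.mem_product.1 hu).1).symm⟩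
  complete := fun u x hx y hy hxy => by
    simp only [Finset.mem_product, Finset.mem_singleton, Finset.mem_univ, and_true] at hx hy
    exact Or.inl ⟨hx.trans hy.symm, fun h => hxy (Prod.ext (hx.trans hy.symm) h)⟩
  edge := fun u v x hx y hy h => by
    simp only [Finset.mem_product, Finset.mem_singleton, Finset.mem_univ, and_true] at hx hy
    subst hx hy
    rcases h with h | ⟨i, j, h1, h2, _⟩ | ⟨i, j, h1, h2, _⟩
    · exact Or.inl h.1
    · rw [h1, h2]; simp
    · rw [h1, h2]; simp
  matching := fun u v huv x hx y hy z hz hxy hxz => by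
    simp only [Finset.mem_product, Finset.mem_singleton, Finset.mem_univ, and_true] at hx hy hz
    subst hx hy
    have hne := huv.ne
    refine Prod.ext hz.symm ?_
    rcases hxy with h | ⟨i, j, h1, h2, h3⟩ | ⟨i, j, h1, h2, h3⟩
    · exact absurd h.1 hne
    · rcases hxz with h | ⟨i', j', h1', h2', h3'⟩ | ⟨i', j', h1', h2', h3'⟩
      · exact absurd (h.1.trans hz) hne
      · rw [h1, Sum.inl.injEq] at h1'
        rw [hz, h2, Sum.inr.injEq] at h2'
        subst h1' h2'
        exact h3.symm.trans h3'
      · rw [h1] at h2'; cases h2'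
    · rcases hxz with h | ⟨i', j', h1', h2', h3'⟩ | ⟨i', j', h1', h2', h3'⟩
      · exact absurd (h.1.trans hz) hne
      · rw [h2] at h1'; cases h1'
      · rw [hz, h1, Sum.inl.injEq] at h1'
        rw [h2, Sum.inr.injEq] at h2'
        subst h1' h2'
        exact (σ (i, j)).injective (h3.trans h3'.symm)

theorem permCover_isFold {a b k : ℕ} (σ : Fin a × Fin b → Equiv.Perm (Fin k)) :
    (permCover σ).IsFold k := fun u => by simp [permCover]

/-- A fractional coloring of `permCover σ` contains sets of the same size in all lists which are
moved off each other by the permutations. -/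
theorem exists_disjoint_of_isFracColoring {a b k : ℕ} {σ : Fin a × Fin b → Equiv.Perm (Fin k)}
    {η : ℝ} {S : Set ((Fin a ⊕ Fin b) × Fin k)} (hS : (permCover σ).IsFracColoring η S) :
    ∃ T : Fin a ⊕ Fin b → Finset (Fin k), (∀ u, (T u).card = ⌈η * k⌉₊) ∧
      ∀ e : Fin a × Fin b,
        Disjoint ((T (Sum.inl e.1)).map (σ e).toEmbedding) (T (Sum.inr e.2)) := by
  classical
  have h1 : ∀ u, ∃ T : Finset (Fin k), (∀ x ∈ T, (u, x) ∈ S) ∧ T.card = ⌈η * k⌉₊ := by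
    intro u
    have h2 := hS.2 u
    rw [permCover_isFold σ u] at h2
    have h3 : (S ∩ ((permCover σ).L u : Set _)).ncard =
        (Finset.univ.filter fun x : Fin k => (u, x) ∈ S).card := by
      rw [← Set.ncard_coe_finset]
      symm
      refine Set.ncard_congr (fun x _ => (u, x)) ?_ ?_ ?_
      · intro x hx
        simp only [Finset.coe_filter, Finset.mem_univ, true_and] at hx
        exact ⟨hx, by simp [permCover]⟩
      · intro x y _ _ h
        exact (Prod.ext_iff.1 h).2
      · rintro ⟨v, x⟩ ⟨hv, hx⟩
        obtain rfl : v = u := Finset.mem_singleton.1 (Finset.mem_product.1 hx).1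
        exact ⟨x, by simpa using hv, rfl⟩
    rw [h3] at h2
    obtain ⟨T, hT, hTc⟩ := Finset.exists_subset_card_eq (Nat.ceil_le.2 h2)
    exact ⟨T, fun x hx => (Finset.mem_filter.1 (hT hx)).2, hTc⟩
  choose T hT hTc using h1
  refine ⟨T, hTc, fun e => Finset.disjoint_left.2 fun y hy hy' => ?_⟩
  obtain ⟨x, hx, rfl⟩ := Finset.mem_map.1 hy
  exact hS.1 (Sum.inl e.1) (Sum.inr e.2) (by simp) _ (hT _ x hx) _ (hT _ _ hy')
    (by simp [permCover]) (by simp [permCover])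
    (Or.inr (Or.inl ⟨e.1, e.2, rfl, rfl, rfl⟩))

/-- This is the bound (ek/s)^s, written through the density s/k that takes the place of η. -/
theorem choose_le_exp {k s : ℕ} (hs : 0 < s) (hk : 0 < k) :
    (k.choose s : ℝ) ≤ Real.exp (s * (1 - Real.log (s / k))) := by
  have hs' : (0 : ℝ) < s := by exact_mod_cast hs
  have hk' : (0 : ℝ) < k := by exact_mod_cast hk
  have h1 := Nat.choose_le_pow_div (α := ℝ) s k
  have h2 := Real.pow_div_factorial_le_exp s hs'.le s
  have h3 : Real.exp (s * (1 - Real.log (s / k))) = Real.exp s * ((k : ℝ) / s) ^ s := by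
    rw [mul_sub, mul_one, Real.exp_sub, Real.exp_nat_mul, Real.exp_log (by positivity),
      div_eq_mul_inv, ← inv_pow, inv_div]
  rw [h3]
  calc (k.choose s : ℝ) ≤ k ^ s / s.factorial := h1
    _ = (s : ℝ) ^ s / s.factorial * ((k : ℝ) / s) ^ s := by rw [div_pow]; field_simp
    _ ≤ _ := by gcongr

/-- First moment bound for random permutations. -/
theorem mul_le_of_forall_isFracColoring {a b k : ℕ} (hk : 0 < k) {η : ℝ} (hη : 0 < η)
    (h : ∀ σ : Fin a × Fin b → Equiv.Perm (Fin k), ∃ S, (permCover σ).IsFracColoring η S) :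
    η * (a * b) ≤ (a + b) * (1 - Real.log η) := by
  classical
  set s := ⌈η * k⌉₊ with hs
  have hk' : (0 : ℝ) < k := by exact_mod_cast hk
  have hs0 : 0 < s := Nat.ceil_pos.2 (by positivity)
  have hs0' : (0 : ℝ) < s := by exact_mod_cast hs0
  let X : Finset (Fin a ⊕ Fin b → Finset (Fin k)) :=
    Fintype.piFinset fun _ => Finset.powersetCard s Finset.univ
  let Y : (Fin a ⊕ Fin b → Finset (Fin k)) → Finset (Fin a × Fin b → Equiv.Perm (Fin k)) :=
    fun T => Fintype.piFinset fun e => Finset.univ.filter fun π : Equiv.Perm (Fin k) =>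
      Disjoint ((T (Sum.inl e.1)).map π.toEmbedding) (T (Sum.inr e.2))
  have hcover : (Finset.univ : Finset (Fin a × Fin b → Equiv.Perm (Fin k))) ⊆ X.biUnion Y := by
    intro σ _
    obtain ⟨S, hS⟩ := h σ
    obtain ⟨T, hT, hTd⟩ := exists_disjoint_of_isFracColoring hS
    refine Finset.mem_biUnion.2 ⟨T, ?_, ?_⟩
    · simp [X, Fintype.mem_piFinset, Finset.mem_powersetCard, hT, hs]
    · simpa [Y, Fintype.mem_piFinset] using fun i j => hTd (i, j)
  have hXc : X.card = k.choose s ^ (a + b) := by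
    simp [X, Fintype.card_piFinset]
  have hYc : ∀ T ∈ X, ((Y T).card : ℝ) ≤
      (k.factorial * Real.exp (-((s : ℝ) ^ 2 / k))) ^ (a * b) := by
    intro T hT
    simp only [X, Fintype.mem_piFinset, Finset.mem_powersetCard] at hT
    rw [Fintype.card_piFinset]
    push_cast
    have hcard : a * b = (Finset.univ : Finset (Fin a × Fin b)).card := by simp
    rw [hcard, ← Finset.prod_const]
    refine Finset.prod_le_prod (fun _ _ => Nat.cast_nonneg _) fun e _ => ?_
    simpa using card_filter_disjoint_map_le (hT (Sum.inl e.1)).2 (hT (Sum.inr e.2)).2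
      (by simpa using hk)
  have hcount : (k.factorial : ℝ) ^ (a * b) ≤ (k.choose s : ℝ) ^ (a + b) *
      (k.factorial * Real.exp (-((s : ℝ) ^ 2 / k))) ^ (a * b) := by
    have h1 : (k.factorial : ℝ) ^ (a * b) =
        ((Finset.univ : Finset (Fin a × Fin b → Equiv.Perm (Fin k))).card : ℝ) := by
      simp [Fintype.card_perm]
    rw [h1]
    calc _ ≤ ((X.biUnion Y).card : ℝ) := by exact_mod_cast Finset.card_le_card hcover
      _ ≤ ∑ T ∈ X, ((Y T).card : ℝ) := by exact_mod_cast Finset.card_biUnion_le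
      _ ≤ ∑ T ∈ X, (k.factorial * Real.exp (-((s : ℝ) ^ 2 / k))) ^ (a * b) :=
        Finset.sum_le_sum hYc
      _ = _ := by rw [Finset.sum_const, nsmul_eq_mul, hXc]; push_cast; ring
  have h1 : (1 : ℝ) ≤ Real.exp (s * (1 - Real.log (s / k))) ^ (a + b) *
      Real.exp (-((s : ℝ) ^ 2 / k)) ^ (a * b) := by
    have hf : (0 : ℝ) < (k.factorial : ℝ) ^ (a * b) := by positivity
    refine le_of_mul_le_mul_left ?_ hf
    rw [mul_one]
    refine hcount.trans ?_
    rw [mul_pow]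
    calc _ ≤ Real.exp (s * (1 - Real.log (s / k))) ^ (a + b) *
          ((k.factorial : ℝ) ^ (a * b) * Real.exp (-((s : ℝ) ^ 2 / k)) ^ (a * b)) := by
          gcongr
          exact choose_le_exp hs0 hk
      _ = _ := by ring
  rw [← Real.exp_nat_mul, ← Real.exp_nat_mul, ← Real.exp_add, Real.one_le_exp_iff] at h1
  push_cast at h1
  -- Taking logarithms and cancelling s leaves an inequality in the density s/k alone. As s/k ≥ η,
  -- and the left side increases while the right side decreases in the density, it passes to η.
  have h2 : (s / k : ℝ) * (a * b) ≤ (a + b) * (1 - Real.log (s / k)) := by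
    refine le_of_mul_le_mul_left ?_ hs0'
    have h3 : (s : ℝ) * (s / k * (a * b)) = a * b * (s ^ 2 / k) := by ring
    rw [h3]
    linarith
  have h4 : η ≤ s / k := (le_div_iff₀ hk').2 (Nat.le_ceil _)
  calc η * (a * b) ≤ (s / k : ℝ) * (a * b) := by gcongr
    _ ≤ _ := h2
    _ ≤ _ := by gcongr

theorem le_chiDP_completeBipartiteGraph {a b : ℕ} {η : ℝ} (hη : 0 < η)
    (h : (a + b) * (1 - Real.log η) < η * (a * b)) :
    (ENNReal.ofReal η)⁻¹ ≤ chiDP (completeBipartiteGraph (Fin a) (Fin b)) := by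
  refine le_iInf₂ fun k hk => ENNReal.inv_le_inv.2 (ENNReal.ofReal_le_ofReal ?_)
  refine Real.sSup_le (fun η' hη' => ?_) hη.le
  by_contra! hlt
  have h1 := mul_le_of_forall_isFracColoring (a := a) (b := b) hk (hη.trans hlt)
    fun σ => hη'.2.2 _ (permCover σ) (permCover_isFold σ)
  have h2 : ((a : ℝ) + b) * (1 - Real.log η') ≤ (a + b) * (1 - Real.log η) := by gcongr
  have h3 : η * (a * b : ℝ) ≤ η' * (a * b) := by gcongr
  linarith

theorem isBipartite_completeBipartiteGraph (α β : Type*) :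
    (completeBipartiteGraph α β).IsBipartite := by
  simpa using (SimpleGraph.CompleteBipartiteGraph.bicoloring α β).colorable

theorem isDegenerate_completeBipartiteGraph (a b : ℕ) :
    IsDegenerate (completeBipartiteGraph (Fin a) (Fin b)) a := by
  -- All edges point to the side of size `a`, so no directed walk has two edges.
  let D : Digraph (Fin a ⊕ Fin b) := ⟨fun u v => u.isRight ∧ v.isLeft⟩
  refine ⟨D, ⟨fun u v => ?_, fun u v h h' => ?_⟩, fun u hu => ?_, fun u => ?_⟩
  · cases u <;> cases v <;> simp [D]
  · cases u <;> simp_all [D]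
  · obtain ⟨w, h1, -⟩ := Relation.TransGen.head'_iff.1 hu
    obtain ⟨w', -, h2⟩ := Relation.TransGen.tail'_iff.1 hu
    cases u <;> simp_all [D]
  · calc _ ≤ (Set.range (Sum.inl : Fin a → Fin a ⊕ Fin b)).encard := by
          refine Set.encard_le_encard fun v hv => ?_
          obtain ⟨i, rfl⟩ := Sum.isLeft_iff.1 hv.2
          exact ⟨i, rfl⟩
      _ = a := by
          rw [← Set.image_univ, Sum.inl_injective.encard_image, Set.encard_univ]
          simp

theorem eventually_le_chiDP_completeBipartiteGraph {ω : ℕ → ℕ}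
    (hω : Tendsto (fun d : ℕ => (ω d : ℝ) / (d : ℝ)) atTop atTop) {ε : ℝ} (hε : 0 < ε) :
    ∀ᶠ d : ℕ in atTop, ENNReal.ofReal ((1 + ε)⁻¹ * (d / Real.log d)) ≤
      chiDP (completeBipartiteGraph (Fin d) (Fin (ω d))) := by
  -- Both d ≤ τ ω(d) and 1 ≤ τ ln d will hold, costing a factor (1 + τ)² ≤ 1 + 3τ ≤ 1 + 3ε/4 < 1 +
  -- ε.
  set τ := min 1 (ε / 4) with hτ
  have hτ0 : 0 < τ := lt_min one_pos (by positivity)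
  have hτ1 : τ ≤ 1 := min_le_left _ _
  have hτε : τ ≤ ε / 4 := min_le_right _ _
  filter_upwards [hω.eventually_ge_atTop (1 / τ),
    (Real.tendsto_log_atTop.comp tendsto_natCast_atTop_atTop).eventually_ge_atTop (1 / τ),
    eventually_ge_atTop 2] with d h1 h2 hd
  have hd' : (2 : ℝ) ≤ d := by exact_mod_cast hd
  have hd0 : (0 : ℝ) < d := by linarith
  have h2 : 1 / τ ≤ Real.log d := h2
  have hL1 : 1 ≤ Real.log d := ((one_le_div hτ0).2 hτ1).trans h2
  have h2' : 1 ≤ τ * Real.log d := by rwa [div_le_iff₀' hτ0] at h2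
  have h1' : (d : ℝ) ≤ τ * ω d := by
    rw [div_le_div_iff₀ hτ0 hd0] at h1
    linarith
  have hω0 : (0 : ℝ) < ω d := by
    by_contra! hcon
    nlinarith
  have hη : 0 < (1 + ε) * (Real.log d / d) := by positivity
  have hlog : 1 - Real.log ((1 + ε) * (Real.log d / d)) ≤ 1 + Real.log d := by
    rw [Real.log_mul (by positivity) (by positivity), Real.log_div (by positivity) hd0.ne']
    have := Real.log_nonneg hL1
    have := Real.log_nonneg (show 1 ≤ 1 + ε by linarith)
    linarith
  have hmain := le_chiDP_completeBipartiteGraph (a := d) (b := ω d) hη ?_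
  · rwa [← ENNReal.ofReal_inv_of_pos hη, mul_inv, inv_div] at hmain
  · calc ((d : ℝ) + ω d) * (1 - Real.log ((1 + ε) * (Real.log d / d)))
        ≤ (d + ω d) * (1 + Real.log d) := by gcongr
      _ ≤ (τ * ω d + ω d) * (τ * Real.log d + Real.log d) := by gcongr
      _ = (1 + τ) ^ 2 * (ω d * Real.log d) := by ring
      _ < (1 + ε) * (ω d * Real.log d) := by
          have : (1 + τ) ^ 2 < 1 + ε := by nlinarith
          gcongr
      _ = _ := by field_simp

theorem exists_chiDP_completeBipartiteGraph_eq (ω : ℕ → ℕ)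
    (hω : Tendsto (fun d : ℕ => (ω d : ℝ) / (d : ℝ)) atTop atTop) :
    ∃ δ : ℕ → ℝ, Tendsto δ atTop (𝓝 0) ∧
      ∀ d : ℕ, 2 ≤ d → chiDP (completeBipartiteGraph (Fin d) (Fin (ω d))) =
        ENNReal.ofReal ((1 + δ d) * ((d : ℝ) / Real.log (d : ℝ))) := by
  obtain ⟨δ', hδ', hle⟩ := exists_chiDP_le_of_isDegenerate.{0}
  set χ : ℕ → ℝ≥0∞ := fun d => chiDP (completeBipartiteGraph (Fin d) (Fin (ω d)))
  have hχ : ∀ d, 2 ≤ d → χ d ≤ ENNReal.ofReal ((1 + δ' d) * ((d : ℝ) / Real.log (d : ℝ))) :=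
    fun d hd => hle d hd _ _ (isBipartite_completeBipartiteGraph _ _)
      (isDegenerate_completeBipartiteGraph d (ω d))
  have hlogpos : ∀ d : ℕ, 2 ≤ d → 0 < Real.log d := fun d hd =>
    Real.log_pos (by exact_mod_cast hd)
  have hpos : ∀ d : ℕ, 2 ≤ d → 0 < (d : ℝ) / Real.log d := fun d hd =>
    div_pos (by exact_mod_cast (by omega : 0 < d)) (hlogpos d hd)
  -- Solving the required equation for δ makes the equality automatic once χ*_DP is finite; the
  -- content is that δ tends to 0.
  refine ⟨fun d => (χ d).toReal / (d / Real.log d) - 1, ?_, fun d hd => ?_⟩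
  · rw [Metric.tendsto_nhds]
    intro ε hε
    filter_upwards [eventually_le_chiDP_completeBipartiteGraph hω (half_pos hε),
      -- The cap 1 keeps 1 + δ'(d) positive, so that the upper bound survives the passage to real
      -- numbers.
      (Metric.tendsto_nhds.1 hδ') (min ε 1) (lt_min hε one_pos), eventually_ge_atTop 2]
      with d h1 h2 hd
    have hp := hpos d hd
    have hu := hχ d hd
    have hfin : χ d ≠ ∞ := (hu.trans_lt ENNReal.ofReal_lt_top).ne
    rw [Real.dist_eq, sub_zero, lt_min_iff, abs_lt, abs_lt] at h2
    have h3 : (χ d).toReal ≤ (1 + δ' d) * ((d : ℝ) / Real.log d) :=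
      ENNReal.toReal_le_of_le_ofReal (mul_nonneg (by linarith) hp.le) hu
    have h4 : (1 + ε / 2)⁻¹ * ((d : ℝ) / Real.log d) ≤ (χ d).toReal :=
      (ENNReal.ofReal_le_iff_le_toReal hfin).1 h1
    rw [← div_le_iff₀ hp] at h3
    rw [← le_div_iff₀ hp] at h4
    have h5 : 1 - ε / 2 ≤ (1 + ε / 2)⁻¹ := by
      rw [← one_div, le_div_iff₀ (by positivity)]
      nlinarith
    rw [Real.dist_eq, sub_zero, abs_lt]
    constructor <;> linarith
  · have hfin : χ d ≠ ∞ := ((hχ d hd).trans_lt ENNReal.ofReal_lt_top).ne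
    rw [add_sub_cancel, div_mul_cancel₀ _ (hpos d hd).ne', ENNReal.ofReal_toReal hfin]

end FracDP

theorem corollary1p7 :
    (∃ δ : ℕ → ℝ, Tendsto δ atTop (𝓝 0) ∧
      ∀ d : ℕ, 2 ≤ d → ∀ (V : Type u) [Finite V] (G : SimpleGraph V),
        G.IsBipartite → FracDP.IsDegenerate G d →
          FracDP.chiDP G ≤ ENNReal.ofReal ((1 + δ d) * ((d : ℝ) / Real.log (d : ℝ)))) ∧
    (∀ ω : ℕ → ℕ, Tendsto (fun d : ℕ => (ω d : ℝ) / (d : ℝ)) atTop atTop →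
      ∃ δ : ℕ → ℝ, Tendsto δ atTop (𝓝 0) ∧
        ∀ d : ℕ, 2 ≤ d →
          FracDP.chiDP (completeBipartiteGraph (Fin d) (Fin (ω d))) =
            ENNReal.ofReal ((1 + δ d) * ((d : ℝ) / Real.log (d : ℝ)))) := by
  exact ⟨FracDP.exists_chiDP_le_of_isDegenerate, FracDP.exists_chiDP_completeBipartiteGraph_eq⟩
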